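/- Let $\alpha\in\mathbb{R}$ and let $\mathbb{A}_\alpha$ be the noncommutative torus, i.e. the universal unital $C^*$-algebra generated by two unitaries $U,V$ with $UV=e^{2\pi i\alpha}VU$, with its canonical trace $\tau$, the state determined by $\tau(U^mV^n)=\delta_{m,0}\delta_{n,0}$ for $m,n\in\mathbb{Z}$. For $\theta\in\mathbb{R}$ and a continuous function $f:\mathbb{T}\to\mathbb{T}$ on the unit circle $\mathbb{T}$, let $\Phi_{\theta,f}$ be the Anzai skew-product, i.e. the $*$-automorphism of $\mathbb{A}_\alpha$ determined by $\Phi_{\theta,f}(U)=e^{i\theta}U$ and $\Phi_{\theta,f}(V)=f(U)V$. Suppose that $\theta/2\pi$ is irrational, and let $f(z)=z_oz$ with $z_o\in\mathbb{T}$. Then, for every $\alpha\in\mathbb{R}$, the $C^*$-dynamical system $(\mathbb{A}_\alpha,\Phi_{\theta,f},\tau)$ is ergodic: $\tau$ is $\Phi_{\theta,f}$-invariant; in the GNS representation $(\mathcal{H}_\tau,\pi_\tau,\xi_\tau)$ the vectors fixed by the isometry $V_{\tau,\Phi_{\theta,f}}$, which is given by $V_{\tau,\Phi_{\theta,f}}\pi_\tau(a)\xi_\tau=\pi_\tau(\Phi_{\theta,f}(a))\xi_\tau$,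 are exactly the multiples of $\xi_\tau$; and $\tau$ is an extreme point of the convex set of $\Phi_{\theta,f}$-invariant states. Hence $(\mathbb{A}_\alpha,\Phi_{\theta,f})$ is uniquely ergodic: $\tau$ is its only invariant state. -/

import Mathlib

noncomputable section

namespace CStarDynamics

variable {A B : Type*} [CStarAlgebra A] [CStarAlgebra B]
/-- The homomorphism of unitary groups induced by a unital `*`-homomorphism. -/
def mapUnitary (φ : A →⋆ₐ[ℂ] B) : unitary A →* unitary B where
  toFun u := ⟨φ u, Unitary.map_mem φ u.2⟩
  map_one' := Subtype.ext (map_one φ)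
  map_mul' u v := Subtype.ext (map_mul φ (u : A) (v : A))

theorem circle_star_mul_self (c : Circle) : star (c : ℂ) * (c : ℂ) = 1 := by
  have := Circle.coe_mul c⁻¹ c
  rw [inv_mul_cancel, Circle.coe_one, Circle.coe_inv_eq_conj] at this
  exact this.symm

/-- The unitary `c u`, for `c` on the unit circle and `u` unitary. -/
def scaleUnitary (c : Circle) (u : unitary A) : unitary A :=
  ⟨(c : ℂ) • (u : A), by
    rw [Unitary.mem_iff]
    constructor
    · rw [star_smul, smul_mul_smul_comm, Unitary.star_mul_self_of_mem u.2, circle_star_mul_self, one_smul]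
    · rw [star_smul, smul_mul_smul_comm, Unitary.mul_star_self_of_mem u.2, mul_comm, circle_star_mul_self, one_smul]⟩

/-- The inclusion of the spectrum of a unitary into the unit circle. -/
def spectrumToCircle (u : unitary A) : C(spectrum ℂ (u : A), Circle) where
  toFun z := ⟨z, spectrum.subset_circle_of_unitary u.2 z.2⟩
  continuous_toFun := by
    exact continuous_subtype_val.subtype_mk _

/-- The continuous functional calculus `f ↦ f(u)` of a unitary `u`, for `f ∈ C(𝕋)`. -/
def circleCalculus (u : unitary A) : C(Circle, ℂ) →⋆ₐ[ℂ] A :=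
  (cfcHom (R := ℂ) (p := IsStarNormal) (a := (u : A)) inferInstance).comp
    (ContinuousMap.compStarAlgHom' ℂ ℂ (spectrumToCircle u))

/-- The inclusion of the unit circle in `ℂ`. -/
def circleCoe : C(Circle, ℂ) := ⟨fun z => z, by fun_prop⟩

theorem circleCalculus_coe (u : unitary A) : circleCalculus u circleCoe = u :=
  cfcHom_id (R := ℂ) (p := IsStarNormal) (a := (u : A)) inferInstance

theorem continuous_circleHom (φ : C(Circle, ℂ) →⋆ₐ[ℂ] A) : Continuous φ :=
  AddMonoidHomClass.continuous_of_bound φ 1 fun x => by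
    simpa using NonUnitalStarAlgHom.norm_apply_le φ x

theorem circleHom_ext {φ ψ : C(Circle, ℂ) →⋆ₐ[ℂ] A} (h : φ circleCoe = ψ circleCoe) : φ = ψ := by
  have : CompactSpace (Submonoid.unitSphere ℂ : Set ℂ) := inferInstanceAs (CompactSpace Circle)
  refine ContinuousMap.starAlgHom_ext_map_X (s := (Submonoid.unitSphere ℂ : Set ℂ)) (φ := φ) (ψ := ψ)
    (continuous_circleHom φ) (continuous_circleHom ψ) ?_
  have e : (Polynomial.toContinuousMapOnAlgHom (Submonoid.unitSphere ℂ : Set ℂ) Polynomial.X :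
      C((Submonoid.unitSphere ℂ : Set ℂ), ℂ)) = circleCoe := by
    ext z
    exact (Polynomial.toContinuousMapOn_apply _ _ z).trans Polynomial.eval_X
  exact (congrArg φ e).trans (h.trans (congrArg ψ e).symm)

theorem map_circleCalculus (φ : A →⋆ₐ[ℂ] B) (u : unitary A) (f : C(Circle, ℂ)) :
    φ (circleCalculus u f) = circleCalculus (mapUnitary φ u) f := by
  refine DFunLike.congr_fun (?_ : φ.comp (circleCalculus u) = _) f
  apply circleHom_ext
  simp [circleCalculus_coe, mapUnitary]

/-- The unitary `f(u)` for a unitary `u` and a continuous function `f : 𝕋 → 𝕋`. -/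
def unitaryCalculus (u : unitary A) : C(Circle, Circle) →* unitary A where
  toFun f := ⟨circleCalculus u (circleCoe.comp f), by
    apply Unitary.map_mem
    rw [Unitary.mem_iff]
    constructor <;> ext z
    · exact circle_star_mul_self (f z)
    · exact (mul_comm _ _).trans (circle_star_mul_self (f z)) ⟩
  map_one' := Subtype.ext <| (map_one (circleCalculus u) :)
  map_mul' f g := Subtype.ext <| (map_mul (circleCalculus u) (circleCoe.comp f) (circleCoe.comp g) :)

theorem map_unitaryCalculus (φ : A →⋆ₐ[ℂ] B) (u : unitary A) (f : C(Circle, Circle)) :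
    φ (unitaryCalculus u f) = unitaryCalculus (mapUnitary φ u) f := map_circleCalculus ..

theorem unitaryCalculus_id (u : unitary A) : unitaryCalculus u (.id Circle) = u :=
  Subtype.ext (circleCalculus_coe u)

theorem unitaryCalculus_const_mul (u : unitary A) (c : Circle) (f : C(Circle, Circle)) :
    unitaryCalculus u (f.comp (ContinuousMap.mulLeft c)) = unitaryCalculus (scaleUnitary c u) f := by
  refine Subtype.ext <| DFunLike.congr_fun (?_ : (circleCalculus u).comp (ContinuousMap.compStarAlgHom' ℂ ℂ (ContinuousMap.mulLeft c)) = circleCalculus (scaleUnitary c u)) (circleCoe.comp f)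
  apply circleHom_ext
  rw [circleCalculus_coe]
  have : circleCoe.comp (ContinuousMap.mulLeft c) = (c : ℂ) • circleCoe := by
    ext z
    exact Circle.coe_mul c z
  simp [this, circleCalculus_coe, scaleUnitary]

theorem commute_unitaryCalculus (u : unitary A) (f : C(Circle, Circle)) :
    Commute u (unitaryCalculus u f) := by
  conv => enter [1]; rw [← unitaryCalculus_id u]
  exact (Commute.all _ _).map _

open scoped ComplexOrder

/-- The states of a unital C⋆-algebra: positive functionals `φ` with `φ 1 = 1`. -/
def stateSpace (A : Type*) [CStarAlgebra A] [PartialOrder A] : Set (A →L[ℂ] ℂ) :=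
  {φ | (∀ a, 0 ≤ a → 0 ≤ φ a) ∧ φ 1 = 1}

variable [PartialOrder A]

/-- The states that are invariant under `Φ`. -/
def invariantStates (Φ : A →⋆ₐ[ℂ] A) : Set (A →L[ℂ] ℂ) :=
  {φ | φ ∈ stateSpace A ∧ ∀ a, φ (Φ a) = φ a}

/-- A state as a bundled positive linear map. -/
def toPositive (φ : A →L[ℂ] ℂ) [StarOrderedRing A] (h : φ ∈ stateSpace A) : A →ₚ[ℂ] ℂ :=
  PositiveLinearMap.mk₀ (φ : A →ₗ[ℂ] ℂ) h.1

variable [StarOrderedRing A]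

/-- The isometry `a ↦ Φ a` of the pre-GNS space of a `Φ`-invariant positive functional. -/
def preKoopman (f : A →ₚ[ℂ] ℂ) (Φ : A →⋆ₐ[ℂ] A) (h : ∀ a, f (Φ a) = f a) : f.PreGNS →ₗᵢ[ℂ] f.PreGNS where
  toLinearMap := f.toPreGNS.toLinearMap ∘ₗ (Φ : A →ₗ[ℂ] A) ∘ₗ f.ofPreGNS.toLinearMap
  norm_map' x := by
    simp [PositiveLinearMap.preGNS_norm_def, ← map_star, ← map_mul, h]

/-- The operator `V` on the GNS space of a `Φ`-invariant positive functional which is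
determined by `V π(a) ξ = π(Φ a) ξ`, with `ξ` the cyclic vector. -/
def koopman (f : A →ₚ[ℂ] ℂ) (Φ : A →⋆ₐ[ℂ] A) (h : ∀ a, f (Φ a) = f a) : f.GNS →L[ℂ] f.GNS :=
  (preKoopman f Φ h).toContinuousLinearMap.completion

/-- The cyclic vector of the GNS representation. -/
def cyclicVector (f : A →ₚ[ℂ] ℂ) : f.GNS := (f.toPreGNS 1 : f.PreGNS)

theorem koopman_gns (f : A →ₚ[ℂ] ℂ) (Φ : A →⋆ₐ[ℂ] A) (h : ∀ a, f (Φ a) = f a) (a : A) :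
  koopman f Φ h (f.gnsStarAlgHom a (cyclicVector f)) = f.gnsStarAlgHom (Φ a) (cyclicVector f) := by
  have h1 (b : A) : f.gnsStarAlgHom b (cyclicVector f) = (f.toPreGNS b : f.PreGNS) := by
    refine (f.gnsNonUnitalStarAlgHom_apply_coe (a := b) (b := f.toPreGNS 1)).trans ?_
    simp
  rw [h1, h1]
  exact ContinuousLinearMap.completion_apply_coe _ _


/-- `(A, Φ, φ)` is ergodic: `φ` is a `Φ`-invariant state, and the vectors of its GNS space that
are fixed by the operator implementing `Φ` are the multiples of the cyclic vector. -/
def IsErgodic (Φ : A →⋆ₐ[ℂ] A) (φ : A →L[ℂ] ℂ) : Prop :=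
  ∃ h : φ ∈ invariantStates Φ,
    {ξ : (toPositive φ h.1).GNS | koopman (toPositive φ h.1) Φ h.2 ξ = ξ} =
      Submodule.span ℂ {cyclicVector (toPositive φ h.1)}

/-- `φ` is an ergodic state: an extreme point of the convex set of invariant states. -/
def IsErgodicState (Φ : A →⋆ₐ[ℂ] A) (φ : A →L[ℂ] ℂ) : Prop :=
  φ ∈ (invariantStates Φ).extremePoints ℝ

/-- `(A, Φ)` is uniquely ergodic, and `φ` is its unique invariant state. -/
def IsUniquelyErgodic (Φ : A →⋆ₐ[ℂ] A) (φ : A →L[ℂ] ℂ) : Prop := invariantStates Φ = {φ}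

end CStarDynamics

open CStarDynamics

namespace NCTorus

open scoped ComplexConjugate

/-- The group `*`-algebra of the free group on two letters, that is, the free unital complex
`*`-algebra on two unitaries. The parameter `α` only serves to equip it with a norm later. -/
def Poly (_α : ℝ) : Type := MonoidAlgebra ℂ (FreeGroup Bool)

variable {α : ℝ}

instance (α : ℝ) : Ring (Poly α) := inferInstanceAs (Ring (MonoidAlgebra ℂ (FreeGroup Bool)))
instance (α : ℝ) : Algebra ℂ (Poly α) :=
  inferInstanceAs (Algebra ℂ (MonoidAlgebra ℂ (FreeGroup Bool)))

namespace Poly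

/-- The element `c g`, for a scalar `c` and a word `g`. -/
def mon (α : ℝ) (c : ℂ) (g : FreeGroup Bool) : Poly α := MonoidAlgebra.single g c

theorem mon_mul (c d : ℂ) (g h : FreeGroup Bool) :
    mon α c g * mon α d h = mon α (c * d) (g * h) := MonoidAlgebra.single_mul_single ..

theorem one_eq : (1 : Poly α) = mon α 1 1 := rfl

theorem smul_mon (c d : ℂ) (g : FreeGroup Bool) : c • mon α d g = mon α (c * d) g := by
  exact MonoidAlgebra.smul_single ..

theorem induction {P : Poly α → Prop} (h0 : P 0) (hadd : ∀ x y, P x → P y → P (x + y))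
    (hmon : ∀ c g, P (mon α c g)) (x : Poly α) : P x :=
  MonoidAlgebra.induction_linear x h0 hadd (fun g c => hmon c g)

/-- The involution, `c g ↦ conj c g⁻¹`. -/
def starHom (α : ℝ) : Poly α →+ Poly α where
  toFun x := MonoidAlgebra.coeff x |>.sum fun g c => mon α (conj c) g⁻¹
  map_zero' := by
    exact Finsupp.sum_zero_index
  map_add' x y := by
    refine Finsupp.sum_add_index' (fun g => ?_) (fun g c d => ?_)
    · simp [mon]; rfl
    · simp [mon]; rfl

theorem starHom_mon (c : ℂ) (g : FreeGroup Bool) :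
    starHom α (mon α c g) = mon α (conj c) g⁻¹ := by
  refine (Finsupp.sum_single_index (h := fun g c => mon α (conj c) g⁻¹) ?_)
  simp [mon]; rfl

instance : StarRing (Poly α) where
  star := starHom α
  star_involutive x := by
    show starHom α (starHom α x) = x
    induction x using induction with
    | h0 => simp
    | hadd x y hx hy => simp [hx, hy]
    | hmon c g => simp [starHom_mon]
  star_mul x y := by
    show starHom α (x * y) = starHom α y * starHom α x
    induction x using induction with
    | h0 => simp
    | hadd x x' hx hx' => simp [add_mul, mul_add, hx, hx']
    | hmon c g =>
      induction y using induction with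
      | h0 => simp
      | hadd y y' hy hy' => simp [add_mul, mul_add, hy, hy']
      | hmon d h => simp [starHom_mon, mon_mul, mul_comm]
  star_add := (starHom α).map_add

theorem star_mon (c : ℂ) (g : FreeGroup Bool) : star (mon α c g) = mon α (conj c) g⁻¹ :=
  starHom_mon c g

instance : StarModule ℂ (Poly α) where
  star_smul c x := by
    induction x using induction with
    | h0 => simp
    | hadd x y hx hy => simp [hx, hy]
    | hmon d g => simp [smul_mon, star_mon]

/-- The first free unitary. -/
def u (α : ℝ) : Poly α := mon α 1 (FreeGroup.of true)
/-- The second free unitary. -/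
def v (α : ℝ) : Poly α := mon α 1 (FreeGroup.of false)

end Poly

/-- The number `e^{2πiα}`. -/
def phase (α : ℝ) : ℂ := Complex.exp (2 * Real.pi * Complex.I * α)

/-- A C⋆-seminorm on the free unital `*`-algebra on two unitaries `u, v` for which the relation
`u v = e^{2πiα} v u` holds. -/
structure IsCStarSeminorm (α : ℝ) (p : Seminorm ℂ (Poly α)) : Prop where
  mul_le : ∀ x y, p (x * y) ≤ p x * p y
  star_mul_self : ∀ x, p (star x * x) = p x ^ 2
  rel : p (Poly.u α * Poly.v α - phase α • (Poly.v α * Poly.u α)) = 0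

theorem IsCStarSeminorm.mon_le {p : Seminorm ℂ (Poly α)} (hp : IsCStarSeminorm α p) (c : ℂ)
    (g : FreeGroup Bool) : p (Poly.mon α c g) ≤ ‖c‖ := by
  have h1 : p 1 ≤ 1 := by
    have := hp.star_mul_self 1
    simp only [star_one, mul_one] at this
    nlinarith [sq_nonneg (p 1 - 1)]
  have h2 : p (Poly.mon α 1 g) ≤ 1 := by
    have := hp.star_mul_self (Poly.mon α 1 g)
    simp only [Poly.star_mon, Poly.mon_mul, map_one, mul_one, inv_mul_cancel, ← Poly.one_eq] at this
    exact abs_le_one_iff_mul_self_le_one.2 (by nlinarith) |> (le_abs_self _).trans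
  have h3 : Poly.mon α c g = c • Poly.mon α 1 g := by simp [Poly.smul_mon]
  rw [h3, map_smul_eq_mul]
  exact mul_le_of_le_one_right (norm_nonneg _) h2

theorem IsCStarSeminorm.zero (α : ℝ) : IsCStarSeminorm α 0 where
  mul_le := by simp
  star_mul_self := by simp
  rel := by simp

instance : Nonempty {p : Seminorm ℂ (Poly α) // IsCStarSeminorm α p} := ⟨⟨0, .zero α⟩⟩

theorem bddAbove (x : Poly α) :
    BddAbove (Set.range fun p : {p : Seminorm ℂ (Poly α) // IsCStarSeminorm α p} => p.1 x) := by
  suffices ∃ C : ℝ, ∀ p : Seminorm ℂ (Poly α), IsCStarSeminorm α p → p x ≤ C by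
    obtain ⟨C, hC⟩ := this
    exact ⟨C, by rintro _ ⟨p, rfl⟩; exact hC p.1 p.2⟩
  induction x using Poly.induction with
  | h0 => exact ⟨0, by simp⟩
  | hadd x y hx hy =>
    obtain ⟨C, hC⟩ := hx
    obtain ⟨D, hD⟩ := hy
    exact ⟨C + D, fun p hp => (map_add_le_add p x y).trans (add_le_add (hC p hp) (hD p hp))⟩
  | hmon c g => exact ⟨‖c‖, fun p hp => hp.mon_le c g⟩

/-- The universal C⋆-seminorm: the supremum of all C⋆-seminorms for which the relation holds. -/
def maxNorm (x : Poly α) : ℝ :=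
  ⨆ p : {p : Seminorm ℂ (Poly α) // IsCStarSeminorm α p}, p.1 x

theorem IsCStarSeminorm.le_maxNorm {p : Seminorm ℂ (Poly α)} (hp : IsCStarSeminorm α p)
    (x : Poly α) : p x ≤ maxNorm x := le_ciSup (bddAbove x) ⟨p, hp⟩

theorem maxNorm_nonneg (x : Poly α) : 0 ≤ maxNorm x := Real.iSup_nonneg fun p => apply_nonneg p.1 x

theorem maxNorm_mul_le (x y : Poly α) : maxNorm (x * y) ≤ maxNorm x * maxNorm y :=
  ciSup_le fun p => (p.2.mul_le x y).trans <|
    mul_le_mul (p.2.le_maxNorm x) (p.2.le_maxNorm y) (apply_nonneg _ _) (maxNorm_nonneg x)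

theorem maxNorm_star_mul_self (x : Poly α) : maxNorm x * maxNorm x ≤ maxNorm (star x * x) := by
  have h : maxNorm x ≤ √(maxNorm (star x * x)) := by
    refine ciSup_le fun p => Real.le_sqrt_of_sq_le ?_
    rw [← p.2.star_mul_self]
    exact p.2.le_maxNorm _
  have := mul_self_le_mul_self (maxNorm_nonneg x) h
  rwa [Real.mul_self_sqrt (maxNorm_nonneg _)] at this

theorem maxNorm_le_star (x : Poly α) : maxNorm x ≤ maxNorm (star x) := by
  by_contra! h
  have h1 := (maxNorm_star_mul_self x).trans (maxNorm_mul_le _ _)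
  nlinarith [maxNorm_nonneg (star x)]

theorem maxNorm_star (x : Poly α) : maxNorm (star x) = maxNorm x :=
  le_antisymm (by simpa using maxNorm_le_star (star x)) (maxNorm_le_star x)

theorem maxNorm_add_le (x y : Poly α) : maxNorm (x + y) ≤ maxNorm x + maxNorm y :=
  ciSup_le fun p => (map_add_le_add p.1 x y).trans <|
    add_le_add (p.2.le_maxNorm x) (p.2.le_maxNorm y)

theorem maxNorm_smul_le (c : ℂ) (x : Poly α) : maxNorm (c • x) ≤ ‖c‖ * maxNorm x :=
  ciSup_le fun p => by
    rw [map_smul_eq_mul]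
    exact mul_le_mul_of_nonneg_left (p.2.le_maxNorm x) (norm_nonneg c)

instance : SeminormedRing (Poly α) :=
  RingSeminorm.toSeminormedRing
    { toFun := maxNorm
      map_zero' := by simp [maxNorm]
      add_le' := maxNorm_add_le
      neg' := fun x => by simp [maxNorm]
      mul_le' := maxNorm_mul_le }

theorem Poly.norm_def (x : Poly α) : ‖x‖ = maxNorm x := rfl

instance : NormedAlgebra ℂ (Poly α) where
  norm_smul_le := maxNorm_smul_le

instance : NormedStarGroup (Poly α) where
  norm_star_le x := (maxNorm_star x).le

end NCTorus

/-- The noncommutative torus: the universal unital C⋆-algebra generated by two unitaries `U, V`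
with `U V = e^{2πiα} V U`, constructed as the Hausdorff completion of the free unital `*`-algebra
on two unitaries for the universal C⋆-seminorm. -/
def NCTorus (α : ℝ) : Type := UniformSpace.Completion (NCTorus.Poly α)

namespace NCTorus

open UniformSpace

variable {α : ℝ}

instance : NormedRing (NCTorus α) := inferInstanceAs (NormedRing (Completion (Poly α)))
instance : CompleteSpace (NCTorus α) := inferInstanceAs (CompleteSpace (Completion (Poly α)))

/-- The canonical map into the completion. -/
def ofPoly : Poly α → NCTorus α := ((↑) : Poly α → Completion (Poly α))

instance : NormedAlgebra ℂ (NCTorus α) where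
  __ : Algebra ℂ (NCTorus α) := inferInstanceAs (Algebra ℂ (Completion (Poly α)))
  norm_smul_le c x := norm_smul_le (β := Completion (Poly α)) c x

theorem ofPoly_add (x y : Poly α) : ofPoly (x + y) = ofPoly x + ofPoly y := Completion.coe_add x y
theorem ofPoly_mul (x y : Poly α) : ofPoly (x * y) = ofPoly x * ofPoly y := Completion.coe_mul x y
theorem ofPoly_one : ofPoly (1 : Poly α) = 1 := rfl
theorem ofPoly_smul (c : ℂ) (x : Poly α) : ofPoly (c • x) = c • ofPoly x := Completion.coe_smul c x
theorem norm_ofPoly (x : Poly α) : ‖ofPoly x‖ = ‖x‖ := Completion.norm_coe x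
theorem continuous_ofPoly : Continuous (ofPoly (α := α)) := Completion.continuous_coe _
theorem denseRange_ofPoly : DenseRange (ofPoly (α := α)) := Completion.denseRange_coe

/-- The involution of the noncommutative torus. -/
def starMap (α : ℝ) : NCTorus α → NCTorus α :=
  Completion.map (star : Poly α → Poly α)

theorem starMap_ofPoly (x : Poly α) : starMap α (ofPoly x) = ofPoly (star x) :=
  Completion.map_coe (starₗᵢ ℂ : Poly α ≃ₗᵢ⋆[ℂ] Poly α).isometry.uniformContinuous x


theorem continuous_starMap : Continuous (starMap α) := Completion.continuous_map

theorem dense_induction {P : NCTorus α → Prop} (hc : IsClosed {x | P x})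
    (h : ∀ x : Poly α, P (ofPoly x)) (x : NCTorus α) : P x :=
  Completion.induction_on x hc h

theorem dense_induction₂ {P : NCTorus α → NCTorus α → Prop}
    (hc : IsClosed {x : NCTorus α × NCTorus α | P x.1 x.2})
    (h : ∀ x y : Poly α, P (ofPoly x) (ofPoly y)) (x y : NCTorus α) : P x y :=
  Completion.induction_on₂ x y hc h

instance : StarRing (NCTorus α) where
  star := starMap α
  star_involutive x := by
    have hc := continuous_starMap (α := α)
    show starMap α (starMap α x) = x
    refine dense_induction (P := fun x => starMap α (starMap α x) = x)
      (isClosed_eq (hc.comp hc) continuous_id) (fun x => ?_) x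
    simp [starMap_ofPoly]
  star_mul x y := by
    have hc := continuous_starMap (α := α)
    show starMap α (x * y) = starMap α y * starMap α x
    refine dense_induction₂ (P := fun x y => starMap α (x * y) = starMap α y * starMap α x)
      (isClosed_eq (by fun_prop) (by fun_prop)) (fun x y => ?_) x y
    simp [starMap_ofPoly, ← ofPoly_mul]
  star_add x y := by
    have hc := continuous_starMap (α := α)
    show starMap α (x + y) = starMap α x + starMap α y
    refine dense_induction₂ (P := fun x y => starMap α (x + y) = starMap α x + starMap α y)
      (isClosed_eq (by fun_prop) (by fun_prop)) (fun x y => ?_) x y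
    simp [starMap_ofPoly, ← ofPoly_add]

theorem star_ofPoly (x : Poly α) : star (ofPoly x) = ofPoly (star x) := starMap_ofPoly x

theorem continuous_star_aux : Continuous (star : NCTorus α → NCTorus α) := continuous_starMap

instance : StarModule ℂ (NCTorus α) where
  star_smul c := dense_induction (P := fun x => star (c • x) = star c • star x)
    (isClosed_eq (continuous_star_aux.comp (continuous_const_smul c))
      (continuous_star_aux.const_smul (star c))) fun x => by
    rw [← ofPoly_smul, star_ofPoly, star_ofPoly, ← ofPoly_smul, star_smul]

instance : CStarRing (NCTorus α) where
  norm_mul_self_le := dense_induction (P := fun x => ‖x‖ * ‖x‖ ≤ ‖star x * x‖)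
    (isClosed_le (continuous_norm.mul continuous_norm)
      (continuous_norm.comp (continuous_star_aux.mul continuous_id))) fun x => by
    rw [star_ofPoly, ← ofPoly_mul, norm_ofPoly, norm_ofPoly]
    exact maxNorm_star_mul_self x

instance : CStarAlgebra (NCTorus α) where

instance : PartialOrder (NCTorus α) := CStarAlgebra.spectralOrder _
instance : StarOrderedRing (NCTorus α) := CStarAlgebra.spectralOrderedRing _

/-- The canonical map into the completion, as a `*`-homomorphism. -/
def ofPolyHom (α : ℝ) : Poly α →⋆ₐ[ℂ] NCTorus α where
  toFun := ofPoly
  map_one' := rfl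
  map_mul' := ofPoly_mul
  map_zero' := rfl
  map_add' := ofPoly_add
  commutes' c := by
    rw [Algebra.algebraMap_eq_smul_one, Algebra.algebraMap_eq_smul_one, ofPoly_smul, ofPoly_one]
  map_star' x := (star_ofPoly x).symm

theorem Poly.u_mem (α : ℝ) : Poly.u α ∈ unitary (Poly α) := by
  simp [Unitary.mem_iff, Poly.u, Poly.star_mon, Poly.mon_mul, Poly.one_eq]

theorem Poly.v_mem (α : ℝ) : Poly.v α ∈ unitary (Poly α) := by
  simp [Unitary.mem_iff, Poly.v, Poly.star_mon, Poly.mon_mul, Poly.one_eq]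

/-- The generator `U`. -/
def U (α : ℝ) : unitary (NCTorus α) :=
  ⟨ofPolyHom α (Poly.u α), Unitary.map_mem (ofPolyHom α) (Poly.u_mem α)⟩
/-- The generator `V`. -/
def V (α : ℝ) : unitary (NCTorus α) :=
  ⟨ofPolyHom α (Poly.v α), Unitary.map_mem (ofPolyHom α) (Poly.v_mem α)⟩

theorem U_mul_V (α : ℝ) :
    (U α * V α : NCTorus α) = phase α • (V α * U α : NCTorus α) := by
  have h : maxNorm (Poly.u α * Poly.v α - phase α • (Poly.v α * Poly.u α)) = 0 := by
    unfold maxNorm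
    simp_rw [fun p : {p : Seminorm ℂ (Poly α) // IsCStarSeminorm α p} => p.2.rel]
    simp
  rw [← Poly.norm_def, ← norm_ofPoly, norm_eq_zero] at h
  have h2 : ofPolyHom α (Poly.u α * Poly.v α - phase α • (Poly.v α * Poly.u α)) = 0 := h
  rw [map_sub, map_smul, map_mul, map_mul, sub_eq_zero] at h2
  exact h2

section lift

variable {B : Type*} [CStarAlgebra B]

/-- The relation `a b = e^{2πiα} b a`. -/
def Rel (α : ℝ) (a b : unitary B) : Prop := (a * b : B) = phase α • (b * a : B)

/-- The homomorphism on the free `*`-algebra that sends the generators to `a` and `b`. -/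
def polyLiftAlgHom (α : ℝ) (a b : unitary B) : Poly α →ₐ[ℂ] B :=
  MonoidAlgebra.lift ℂ B (FreeGroup Bool)
    ((unitary B).subtype.comp (FreeGroup.lift fun i => bif i then a else b))

theorem polyLiftAlgHom_mon (a b : unitary B) (c : ℂ) (g : FreeGroup Bool) :
    polyLiftAlgHom α a b (Poly.mon α c g) =
      c • (FreeGroup.lift (fun i => bif i then a else b) g : B) :=
  MonoidAlgebra.lift_single _ _ _

/-- The homomorphism on the free `*`-algebra that sends the generators to `a` and `b`. -/
def polyLift (α : ℝ) (a b : unitary B) : Poly α →⋆ₐ[ℂ] B where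
  __ := polyLiftAlgHom α a b
  map_star' x := by
    show polyLiftAlgHom α a b (star x) = star (polyLiftAlgHom α a b x)
    induction x using Poly.induction with
    | h0 => simp
    | hadd x y hx hy => simp [hx, hy]
    | hmon c g => rw [Poly.star_mon, polyLiftAlgHom_mon, polyLiftAlgHom_mon, star_smul, map_inv]; rfl

theorem polyLift_u (a b : unitary B) : polyLift α a b (Poly.u α) = a := by
  refine (polyLiftAlgHom_mon a b 1 _).trans ?_
  simp

theorem polyLift_v (a b : unitary B) : polyLift α a b (Poly.v α) = b := by
  refine (polyLiftAlgHom_mon a b 1 _).trans ?_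
  simp

theorem norm_polyLift_le {a b : unitary B} (h : Rel α a b) (x : Poly α) :
    ‖polyLift α a b x‖ ≤ ‖x‖ := by
  let p : Seminorm ℂ (Poly α) :=
    Seminorm.of (fun x => ‖polyLift α a b x‖) (fun x y => by simpa using norm_add_le _ _)
      (fun c x => by simp [norm_smul])
  have hp : IsCStarSeminorm α p :=
    { mul_le := fun x y => by
        show ‖polyLift α a b (x * y)‖ ≤ ‖polyLift α a b x‖ * ‖polyLift α a b y‖
        rw [map_mul]
        exact norm_mul_le _ _
      star_mul_self := fun x => by
        show ‖polyLift α a b (star x * x)‖ = ‖polyLift α a b x‖ ^ 2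
        rw [map_mul, map_star, CStarRing.norm_star_mul_self, sq]
      rel := by
        show ‖polyLift α a b _‖ = 0
        rw [map_sub, map_smul, map_mul, map_mul, polyLift_u, polyLift_v, norm_eq_zero, sub_eq_zero]
        exact h }
  exact hp.le_maxNorm x

theorem continuous_polyLift {a b : unitary B} (h : Rel α a b) : Continuous (polyLift α a b) :=
  AddMonoidHomClass.continuous_of_bound (polyLift α a b) 1 fun x => by
    simpa using norm_polyLift_le h x

/-- The extension of `polyLift` to the completion. -/
def liftRingHom {a b : unitary B} (h : Rel α a b) : NCTorus α →+* B :=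
  (Completion.extensionHom ((polyLift α a b).toRingHom) (continuous_polyLift h))

theorem continuous_liftRingHom {a b : unitary B} (h : Rel α a b) : Continuous (liftRingHom h) :=
  Completion.continuous_extension

theorem liftRingHom_ofPoly {a b : unitary B} (h : Rel α a b) (x : Poly α) :
    liftRingHom h (ofPoly x) = polyLift α a b x :=
  Completion.extensionHom_coe _ (continuous_polyLift h) x

/-- The `*`-homomorphism given by the universal property. -/
def lift {a b : unitary B} (h : Rel α a b) : NCTorus α →⋆ₐ[ℂ] B where
  __ := liftRingHom h
  commutes' c := by
    show liftRingHom h (algebraMap ℂ (NCTorus α) c) = _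
    rw [← AlgHomClass.commutes (ofPolyHom α) c]
    refine (liftRingHom_ofPoly h _).trans ?_
    exact AlgHomClass.commutes _ c
  map_star' := by
    show ∀ x, liftRingHom h (star x) = star (liftRingHom h x)
    have hc := continuous_liftRingHom h
    refine dense_induction (isClosed_eq (hc.comp continuous_star_aux) hc.star) fun x => ?_
    rw [star_ofPoly, liftRingHom_ofPoly, liftRingHom_ofPoly, map_star]

theorem lift_U {a b : unitary B} (h : Rel α a b) : lift h (U α) = a :=
  (liftRingHom_ofPoly h _).trans (polyLift_u a b)

theorem lift_V {a b : unitary B} (h : Rel α a b) : lift h (V α) = b :=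
  (liftRingHom_ofPoly h _).trans (polyLift_v a b)

theorem continuous_hom (φ : NCTorus α →⋆ₐ[ℂ] B) : Continuous φ :=
  AddMonoidHomClass.continuous_of_bound φ 1 fun x => by
    simpa using NonUnitalStarAlgHom.norm_apply_le φ x

theorem polyHom_ext {φ ψ : Poly α →⋆ₐ[ℂ] B} (hu : φ (Poly.u α) = ψ (Poly.u α))
    (hv : φ (Poly.v α) = ψ (Poly.v α)) : φ = ψ := by
  ext x
  induction x using Poly.induction with
  | h0 => simp
  | hadd x y hx hy => simp [hx, hy]
  | hmon c g =>
    have hg : φ (Poly.mon α 1 g) = ψ (Poly.mon α 1 g) := by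
      induction g using FreeGroup.induction_on with
      | C1 => rw [← Poly.one_eq, map_one, map_one]
      | of i => cases i <;> assumption
      | inv_of i h =>
        have h' := congrArg star h
        simpa only [← map_star, Poly.star_mon, map_one] using h'
      | mul g h hg hh =>
        have : Poly.mon α 1 (g * h) = Poly.mon α 1 g * Poly.mon α 1 h := by
          rw [Poly.mon_mul, one_mul]
        rw [this, map_mul, map_mul, hg, hh]
    have h : Poly.mon α c g = c • Poly.mon α 1 g := by simp [Poly.smul_mon]
    rw [h, map_smul, map_smul, hg]

theorem hom_ext {φ ψ : NCTorus α →⋆ₐ[ℂ] B} (hU : φ (U α) = ψ (U α)) (hV : φ (V α) = ψ (V α)) :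
    φ = ψ := by
  have h : φ.comp (ofPolyHom α) = ψ.comp (ofPolyHom α) := polyHom_ext hU hV
  ext x
  refine dense_induction (P := fun x => φ x = ψ x)
    (isClosed_eq (continuous_hom φ) (continuous_hom ψ)) (fun x => ?_) x
  exact DFunLike.congr_fun h x

/-- The universal property of the noncommutative torus. -/
theorem existsUnique_hom {a b : unitary B} (h : (a * b : B) = phase α • (b * a : B)) :
    ∃! φ : NCTorus α →⋆ₐ[ℂ] B, φ (U α) = a ∧ φ (V α) = b :=
  ⟨lift h, ⟨lift_U h, lift_V h⟩, fun _ hφ =>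
    hom_ext (hφ.1.trans (lift_U h).symm) (hφ.2.trans (lift_V h).symm)⟩

end lift

section regularRepresentation

open scoped ENNReal ComplexOrder InnerProductSpace

/-- The Hilbert space `ℓ²(ℤ × ℤ)`. -/
abbrev L2Z2 : Type := lp (fun _ : ℤ × ℤ => ℂ) 2

theorem memℓp_weighted (c : ℤ × ℤ → Circle) (σ : Equiv.Perm (ℤ × ℤ)) (x : L2Z2) :
    Memℓp (fun i => (c i : ℂ) * x (σ i)) 2 := by
  have h := (memℓp_gen_iff (by norm_num)).1 (lp.memℓp x)
  refine (memℓp_gen_iff (by norm_num)).2 ?_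
  simp only [norm_mul, Circle.norm_coe, one_mul]
  exact σ.summable_iff.2 h

/-- The weighted permutation operator `(W x)(i) = c i * x (σ i)` on `ℓ²(ℤ × ℤ)`. -/
def weightedPerm (c : ℤ × ℤ → Circle) (σ : Equiv.Perm (ℤ × ℤ)) : L2Z2 ≃ₗᵢ[ℂ] L2Z2 where
  toFun x := ⟨fun i => (c i : ℂ) * x (σ i), memℓp_weighted c σ x⟩
  invFun x := ⟨fun i => (((c (σ.symm i))⁻¹ : Circle) : ℂ) * x (σ.symm i),
    memℓp_weighted (fun i => (c (σ.symm i))⁻¹) σ.symm x⟩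
  left_inv x := by ext i; simp
  right_inv x := by ext i; simp
  map_add' x y := by ext i; exact mul_add _ _ _
  map_smul' a x := by ext i; simp [mul_left_comm]
  norm_map' x := by
    rw [lp.norm_eq_tsum_rpow (by norm_num), lp.norm_eq_tsum_rpow (by norm_num)]
    congr 1
    rw [← σ.tsum_eq (fun i => ‖x i‖ ^ (2 : ℝ≥0∞).toReal)]
    refine tsum_congr fun i => ?_
    show ‖(c i : ℂ) * x (σ i)‖ ^ _ = _
    rw [norm_mul, Circle.norm_coe, one_mul]

theorem weightedPerm_apply (c : ℤ × ℤ → Circle) (σ : Equiv.Perm (ℤ × ℤ)) (x : L2Z2) (i : ℤ × ℤ) :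
    weightedPerm c σ x i = c i * x (σ i) := rfl

/-- The shift `e (m, n) ↦ e (m + 1, n)`. -/
def regU : unitary (L2Z2 →L[ℂ] L2Z2) :=
  Unitary.linearIsometryEquiv.symm (weightedPerm 1 (Equiv.addRight (-1, 0)))

/-- The weighted shift `e (m, n) ↦ e^{-2πiαm} e (m, n + 1)`. -/
def regV (α : ℝ) : unitary (L2Z2 →L[ℂ] L2Z2) :=
  Unitary.linearIsometryEquiv.symm
    (weightedPerm (fun i => Circle.exp (2 * Real.pi * α) ^ (-i.1)) (Equiv.addRight (0, -1)))

theorem regU_apply (x : L2Z2) (i : ℤ × ℤ) :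
    (regU : L2Z2 →L[ℂ] L2Z2) x i = x (i + (-1, 0)) :=
  one_mul _

theorem regV_apply (α : ℝ) (x : L2Z2) (i : ℤ × ℤ) :
    (regV α : L2Z2 →L[ℂ] L2Z2) x i =
      (Circle.exp (2 * Real.pi * α) ^ (-i.1) : Circle) * x (i + (0, -1)) := rfl

theorem phase_eq (α : ℝ) : phase α = Circle.exp (2 * Real.pi * α) := by
  rw [phase, Circle.coe_exp]; congr 1; push_cast; ring

theorem reg_rel (α : ℝ) : (regU * regV α : L2Z2 →L[ℂ] L2Z2) = phase α • (regV α * regU : L2Z2 →L[ℂ] L2Z2) := by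
  ext x i
  show (regU : L2Z2 →L[ℂ] L2Z2) ((regV α : L2Z2 →L[ℂ] L2Z2) x) i =
    phase α * (regV α : L2Z2 →L[ℂ] L2Z2) ((regU : L2Z2 →L[ℂ] L2Z2) x) i
  rw [regU_apply, regV_apply, regV_apply, regU_apply, phase_eq, ← mul_assoc, ← Circle.coe_mul,
    ← zpow_one_add]
  have h1 : -(i + (-1, 0)).1 = 1 + -i.1 := by simp
  have h2 : i + (-1, 0) + (0, -1) = i + (0, -1) + (-1, 0) := by abel
  rw [h1, h2]


theorem regV_single (α : ℝ) (n : ℤ) :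
    (regV α : L2Z2 →L[ℂ] L2Z2) (lp.single 2 (0, n) 1) = lp.single 2 (0, n + 1) 1 := by
  ext i
  rw [regV_apply, lp.single_apply, lp.single_apply]
  obtain ⟨a, b⟩ := i
  by_cases ha : a = 0
  · subst ha
    simp [Pi.single_apply, ← sub_eq_add_neg, sub_eq_iff_eq_add]
  · simp [ha]

theorem regU_single (m n : ℤ) :
    (regU : L2Z2 →L[ℂ] L2Z2) (lp.single 2 (m, n) 1) = lp.single 2 (m + 1, n) 1 := by
  ext i
  rw [regU_apply, lp.single_apply, lp.single_apply]
  obtain ⟨a, b⟩ := i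
  simp [Pi.single_apply, ← sub_eq_add_neg, sub_eq_iff_eq_add]

theorem zpow_shift (w : unitary (L2Z2 →L[ℂ] L2Z2)) (s : ℤ → L2Z2)
    (h : ∀ n, (w : L2Z2 →L[ℂ] L2Z2) (s n) = s (n + 1)) (k : ℤ) :
    ((w ^ k : unitary (L2Z2 →L[ℂ] L2Z2)) : L2Z2 →L[ℂ] L2Z2) (s 0) = s k := by
  have h' (n : ℤ) : ((w⁻¹ : unitary (L2Z2 →L[ℂ] L2Z2)) : L2Z2 →L[ℂ] L2Z2) (s (n + 1)) = s n := by
    rw [← h]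
    have : ((w⁻¹ * w : unitary (L2Z2 →L[ℂ] L2Z2)) : L2Z2 →L[ℂ] L2Z2) (s n) = s n := by
      rw [inv_mul_cancel]; rfl
    exact this
  induction k using Int.induction_on with
  | zero => rfl
  | succ k ih =>
    rw [add_comm, zpow_add, zpow_one, add_comm, ← h, ← ih]; rfl
  | pred k ih =>
    rw [sub_eq_neg_add, zpow_add, zpow_neg_one, ← h' (-1 + _), ← sub_eq_neg_add, sub_add_cancel, ← ih]; rfl


/-- The representation of the noncommutative torus by the two shifts. -/
def regularRep (α : ℝ) : NCTorus α →⋆ₐ[ℂ] (L2Z2 →L[ℂ] L2Z2) := lift (reg_rel α)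

/-- The canonical trace `τ`, as the vector state of `e (0, 0)`. It is the bounded functional with
`τ (U ^ m * V ^ n) = δ_{m,0} δ_{n,0}`, by `trace_zpow`. -/
def trace (α : ℝ) : NCTorus α →L[ℂ] ℂ where
  toFun x := ⟪(lp.single 2 (0, 0) 1 : L2Z2), regularRep α x (lp.single 2 (0, 0) 1)⟫_ℂ
  map_add' x y := by rw [map_add, add_apply, inner_add_right]
  map_smul' c x := by
    rw [map_smul, smul_apply, inner_smul_right]; rfl
  cont := by
    have := continuous_hom (regularRep α)
    fun_prop

theorem trace_apply (x : NCTorus α) : trace α x =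
    ⟪(lp.single 2 (0, 0) 1 : L2Z2), regularRep α x (lp.single 2 (0, 0) 1)⟫_ℂ := rfl

theorem trace_mem_stateSpace (α : ℝ) : trace α ∈ stateSpace (NCTorus α) := by
  constructor
  · intro a ha
    obtain ⟨b, rfl⟩ := CStarAlgebra.nonneg_iff_eq_star_mul_self.1 ha
    rw [trace_apply, map_mul, map_star, ContinuousLinearMap.star_eq_adjoint,
      mul_apply_eq_comp, ContinuousLinearMap.adjoint_inner_right]
    exact inner_self_eq_norm_sq_to_K (𝕜 := ℂ) (regularRep α b (lp.single 2 (0, 0) 1)) ▸ by positivity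
  · rw [trace_apply, map_one, one_apply_eq_self, inner_self_eq_norm_sq_to_K,
      lp.norm_single (by norm_num)]
    simp

theorem trace_zpow (α : ℝ) (m n : ℤ) :
    trace α ((U α ^ m * V α ^ n : unitary (NCTorus α)) : NCTorus α) =
      if m = 0 ∧ n = 0 then 1 else 0 := by
  have h (w : unitary (NCTorus α)) (k : ℤ) :
      regularRep α ((w ^ k : unitary (NCTorus α)) : NCTorus α) =
        ((mapUnitary (regularRep α) w ^ k : unitary (L2Z2 →L[ℂ] L2Z2)) : L2Z2 →L[ℂ] L2Z2) := by
    exact congrArg Subtype.val (map_zpow (mapUnitary (regularRep α)) w k)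
  have hU : mapUnitary (regularRep α) (U α) = regU := Subtype.ext (lift_U _)
  have hV : mapUnitary (regularRep α) (V α) = regV α := Subtype.ext (lift_V _)
  have e : regularRep α ((U α ^ m * V α ^ n : unitary (NCTorus α)) : NCTorus α)
      (lp.single 2 (0, 0) 1) = lp.single 2 (m, n) 1 := by
    rw [Submonoid.coe_mul, map_mul, h, h, hU, hV, mul_apply_eq_comp,
      zpow_shift (regV α) (fun n => lp.single 2 (0, n) 1) (regV_single α) n]
    exact zpow_shift regU (fun m => lp.single 2 (m, n) 1) (fun m => regU_single m n) m
  rw [trace_apply, e, lp.inner_single_left]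
  simp [Pi.single_apply, eq_comm]

end regularRepresentation

section anzai

theorem anzai_rel (α θ : ℝ) (f : C(Circle, Circle)) :
    Rel α (scaleUnitary (Circle.exp θ) (U α)) (unitaryCalculus (U α) f * V α) := by
  have h := commute_unitaryCalculus (U α) f
  have h' : (U α : NCTorus α) * unitaryCalculus (U α) f = unitaryCalculus (U α) f * U α :=
    congrArg Subtype.val h.eq
  have hr := U_mul_V α
  simp only [Rel, scaleUnitary, Submonoid.coe_mul, smul_mul_assoc, mul_smul_comm]
  rw [← mul_assoc, h', mul_assoc, hr, mul_smul_comm, smul_comm, mul_assoc]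

/-- The `*`-endomorphism with `U ↦ e^{iθ} U` and `V ↦ f(U) V`. -/
def anzaiHom (α θ : ℝ) (f : C(Circle, Circle)) : NCTorus α →⋆ₐ[ℂ] NCTorus α :=
  lift (anzai_rel α θ f)

theorem anzaiHom_U (α θ : ℝ) (f : C(Circle, Circle)) :
    anzaiHom α θ f (U α) = (Circle.exp θ : ℂ) • (U α : NCTorus α) := lift_U _

theorem anzaiHom_V (α θ : ℝ) (f : C(Circle, Circle)) :
    anzaiHom α θ f (V α) = (unitaryCalculus (U α) f : NCTorus α) * V α := lift_V _

theorem anzaiHom_comp (α θ : ℝ) (f g : C(Circle, Circle))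
    (h : g.comp (ContinuousMap.mulLeft (Circle.exp θ)) = f⁻¹) :
    (anzaiHom α θ f).comp (anzaiHom α (-θ) g) = StarAlgHom.id ℂ (NCTorus α) := by
  apply hom_ext
  · simp only [StarAlgHom.comp_apply, anzaiHom_U, map_smul, smul_smul, ← Circle.coe_mul,
      ← Circle.exp_add, neg_add_cancel, Circle.exp_zero, Circle.coe_one, one_smul]
    rfl
  · have hU : mapUnitary (anzaiHom α θ f) (U α) = scaleUnitary (Circle.exp θ) (U α) :=
      Subtype.ext (anzaiHom_U α θ f)
    rw [StarAlgHom.comp_apply, anzaiHom_V, map_mul, anzaiHom_V, map_unitaryCalculus, hU,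
      ← unitaryCalculus_const_mul, h, map_inv, ← mul_assoc, ← Submonoid.coe_mul, inv_mul_cancel]
    simp

/-- The Anzai skew-product: the `*`-automorphism with `U ↦ e^{iθ} U` and `V ↦ f(U) V`. -/
def anzai (α θ : ℝ) (f : C(Circle, Circle)) : NCTorus α ≃⋆ₐ[ℂ] NCTorus α :=
  StarAlgEquiv.ofStarAlgHom (anzaiHom α θ f)
    (anzaiHom α (-θ) (f.comp (ContinuousMap.mulLeft (Circle.exp (-θ))))⁻¹)
    (by
      have := anzaiHom_comp α (-θ) (f.comp (ContinuousMap.mulLeft (Circle.exp (-θ))))⁻¹ f (by simp)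
      rwa [neg_neg] at this)
    (anzaiHom_comp α θ f _ (by
      ext z
      simp [← mul_assoc]))

theorem anzai_U (α θ : ℝ) (f : C(Circle, Circle)) :
    anzai α θ f (U α) = (Circle.exp θ : ℂ) • (U α : NCTorus α) := anzaiHom_U α θ f

theorem anzai_V (α θ : ℝ) (f : C(Circle, Circle)) :
    anzai α θ f (V α) = (unitaryCalculus (U α) f : NCTorus α) * V α := anzaiHom_V α θ f

end anzai

end NCTorus

end

/-! Modulo scalar unitaries, `U` and `V` commute whatever `α` is. So the products `U ^ m * V ^ n`
are indexed by `ℤ × ℤ`, and `Φ` acts on them, up to a phase, by the shear `(m, n) ↦ (m + n, n)`. The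
phases themselves never matter, except on powers of `U`, where `Φ` multiplies `U ^ m` by `e^{imθ}`,
which is not `1` for `m ≠ 0`.

Let `φ` be any invariant state, with cyclic vector `Ω`, and let `ξ` be a fixed vector of its GNS
space. The functional `a ↦ ⟪Ω, π(a) ξ⟫` vanishes on `U ^ m * V ^ n` unless `m = n = 0`. For `n = 0`
this holds because eigenvectors with eigenvalue other than `1` are orthogonal to `ξ`. For `n ≠ 0`,
the orbit of `π((U ^ m * V ^ n)*) Ω` is orthonormal: its inner products are values of `φ` at phases
times `U ^ ((i - j) * n)`, which vanish for `i ≠ j` (`orthonormal_orbit_star_weyl`). A fixed vector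
has the same inner product with every member of the orbit, so Bessel's inequality makes that product
zero.

Hence the functional is a multiple of the trace (`cyclicFunctional_eq_smul_trace`). With `φ`
arbitrary and `ξ = Ω` this is unique ergodicity; with `φ` the trace and `ξ` arbitrary it says that
the fixed vectors are the multiples of `Ω`. Extremality is then automatic, the set of invariant
states being a singleton. -/

noncomputable section

namespace CStarDynamics

open scoped InnerProductSpace ComplexOrder

/-! ### Fixed vectors and orthonormal orbits -/

section Hilbert

variable {H : Type*} [SeminormedAddCommGroup H] [InnerProductSpace ℂ H]

/-- A fixed vector of an inner-product-preserving map is orthogonal to every vector with an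
orthonormal orbit. -/
theorem inner_eq_zero_of_orthonormal_orbit {T : H → H} (hT : ∀ x y, ⟪T x, T y⟫_ℂ = ⟪x, y⟫_ℂ)
    {ξ v : H} (hξ : T ξ = ξ) (hv : Orthonormal ℂ fun k : ℕ => T^[k] v) : ⟪v, ξ⟫_ℂ = 0 := by
  have h (k : ℕ) : ⟪T^[k] v, ξ⟫_ℂ = ⟪v, ξ⟫_ℂ := by
    induction k with
    | zero => rfl
    | succ k ih => rw [Function.iterate_succ_apply', ← ih, ← hT (T^[k] v) ξ, hξ]
  -- Bessel: the squared norms of the inner products are summable, but they are all equal and the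
  -- index set `ℕ` is infinite.
  have hs := hv.inner_products_summable (x := ξ)
  simp only [h, summable_const_iff] at hs
  simpa using hs

end Hilbert

/-! ### Unitaries modulo scalars -/

section Phases

variable {A B : Type*} [CStarAlgebra A] [CStarAlgebra B]

theorem coe_scaleUnitary (c : Circle) (u : unitary A) :
    (scaleUnitary c u : A) = (c : ℂ) • (u : A) := rfl

/-- The scalar unitaries, as a homomorphism from the circle. -/
def scalarUnitary (A : Type*) [CStarAlgebra A] : Circle →* unitary A where
  toFun c := scaleUnitary c 1
  map_one' := Subtype.ext (by simp [coe_scaleUnitary])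
  map_mul' c d := Subtype.ext (by simp [coe_scaleUnitary, smul_smul, mul_comm])

theorem scalarUnitary_mul (c : Circle) (u : unitary A) :
    scalarUnitary A c * u = scaleUnitary c u :=
  Subtype.ext (by simp [scalarUnitary, coe_scaleUnitary])

theorem mul_scalarUnitary (c : Circle) (u : unitary A) :
    u * scalarUnitary A c = scaleUnitary c u :=
  Subtype.ext (by simp [scalarUnitary, coe_scaleUnitary])

/-- Scalars are central, so conjugation does not move them. -/
instance : (scalarUnitary A).range.Normal where
  conj_mem := by
    rintro _ ⟨c, rfl⟩ u
    exact ⟨c, by rw [mul_scalarUnitary, ← scalarUnitary_mul, mul_assoc, mul_inv_cancel, mul_one]⟩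

/-- The projective unitary group: unitaries modulo scalars. -/
abbrev ProjUnitary (A : Type*) [CStarAlgebra A] : Type _ := unitary A ⧸ (scalarUnitary A).range

/-- The class of a unitary modulo scalars. -/
def projUnitary (A : Type*) [CStarAlgebra A] : unitary A →* ProjUnitary A :=
  QuotientGroup.mk' (scalarUnitary A).range

/-- This turns "equal up to some phase" into an equation in a group, so that phases need not be
tracked in the computations below. -/
theorem projUnitary_eq_iff {u v : unitary A} :
    projUnitary A u = projUnitary A v ↔ ∃ c : Circle, u = scaleUnitary c v := by
  refine eq_comm.trans (QuotientGroup.eq.trans ?_)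
  refine exists_congr fun c => ?_
  rw [← mul_scalarUnitary, eq_inv_mul_iff_mul_eq, eq_comm]

theorem projUnitary_scaleUnitary (c : Circle) (u : unitary A) :
    projUnitary A (scaleUnitary c u) = projUnitary A u := projUnitary_eq_iff.2 ⟨c, rfl⟩

theorem mapUnitary_scaleUnitary (φ : A →⋆ₐ[ℂ] B) (c : Circle) (u : unitary A) :
    mapUnitary φ (scaleUnitary c u) = scaleUnitary c (mapUnitary φ u) :=
  Subtype.ext (map_smul φ (c : ℂ) (u : A))

end Phases

/-! ### The GNS space and functionals attached to its vectors -/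

section GNS

variable {A : Type*} [CStarAlgebra A] [PartialOrder A] [StarOrderedRing A]

theorem gns_cyclicVector (f : A →ₚ[ℂ] ℂ) (a : A) :
    f.gnsStarAlgHom a (cyclicVector f) = (f.toPreGNS a : f.PreGNS) := by
  refine (f.gnsNonUnitalStarAlgHom_apply_coe (a := a) (b := f.toPreGNS 1)).trans ?_
  simp

theorem inner_gns_cyclicVector (f : A →ₚ[ℂ] ℂ) (a b : A) :
    ⟪f.gnsStarAlgHom a (cyclicVector f), f.gnsStarAlgHom b (cyclicVector f)⟫_ℂ =
      f (star a * b) := by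
  rw [gns_cyclicVector, gns_cyclicVector]
  exact UniformSpace.Completion.inner_coe _ _

theorem gns_one_cyclicVector (f : A →ₚ[ℂ] ℂ) :
    f.gnsStarAlgHom 1 (cyclicVector f) = cyclicVector f := by
  rw [gns_cyclicVector]; rfl

theorem koopman_cyclicVector (f : A →ₚ[ℂ] ℂ) (Φ : A →⋆ₐ[ℂ] A) (h : ∀ a, f (Φ a) = f a) :
    koopman f Φ h (cyclicVector f) = cyclicVector f := by
  have := koopman_gns f Φ h 1
  rwa [map_one Φ, gns_one_cyclicVector] at this

/-- By density it suffices to compare vectors `π(a) Ω` and `π(b) Ω`, where the claim is the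
invariance of `f` at `star a * b`. -/
theorem inner_koopman (f : A →ₚ[ℂ] ℂ) (Φ : A →⋆ₐ[ℂ] A) (h : ∀ a, f (Φ a) = f a)
    (x y : f.GNS) : ⟪koopman f Φ h x, koopman f Φ h y⟫_ℂ = ⟪x, y⟫_ℂ := by
  induction x, y using UniformSpace.Completion.induction_on₂ with
  | hp => apply isClosed_eq <;> fun_prop
  | ih x y =>
    have e (z : f.PreGNS) : (z : f.GNS) = f.gnsStarAlgHom (f.ofPreGNS z) (cyclicVector f) :=
      (gns_cyclicVector f _).symm
    rw [e x, e y, koopman_gns, koopman_gns, inner_gns_cyclicVector, inner_gns_cyclicVector,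
      ← map_star, ← map_mul, h]

theorem koopman_iterate_gns (f : A →ₚ[ℂ] ℂ) (Φ : A →⋆ₐ[ℂ] A) (h : ∀ a, f (Φ a) = f a) (k : ℕ)
    (a : A) : (koopman f Φ h)^[k] (f.gnsStarAlgHom a (cyclicVector f)) =
      f.gnsStarAlgHom (Φ^[k] a) (cyclicVector f) := by
  induction k with
  | zero => rfl
  | succ k ih => rw [Function.iterate_succ_apply', Function.iterate_succ_apply', ih, koopman_gns]

/-- The functional `a ↦ ⟪Ω, π(a) ξ⟫` on `A`, for a vector `ξ` of the GNS space. -/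
def cyclicFunctional (f : A →ₚ[ℂ] ℂ) (ξ : f.GNS) : A →L[ℂ] ℂ :=
  LinearMap.mkContinuous
    { toFun := fun a => ⟪cyclicVector f, f.gnsStarAlgHom a ξ⟫_ℂ
      map_add' := fun a b => by
        rw [map_add, add_apply, inner_add_right]
      map_smul' := fun c a => by
        rw [map_smul, smul_apply, inner_smul_right]; rfl }
    (‖cyclicVector f‖ * ‖ξ‖) fun a => by
      refine (norm_inner_le_norm (𝕜 := ℂ) (cyclicVector f) (f.gnsStarAlgHom a ξ)).trans ?_
      rw [mul_assoc, mul_comm ‖ξ‖]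
      gcongr
      refine ((f.gnsStarAlgHom a).le_opNorm ξ).trans ?_
      gcongr
      exact NonUnitalStarAlgHom.norm_apply_le f.gnsStarAlgHom a

/-- Taking the adjoint of `π(a)` leaves `ξ` alone in the second slot, where its being fixed can be
used. This is the source of the stars on the Weyl unitaries below. -/
theorem cyclicFunctional_apply (f : A →ₚ[ℂ] ℂ) (ξ : f.GNS) (a : A) :
    cyclicFunctional f ξ a = ⟪f.gnsStarAlgHom (star a) (cyclicVector f), ξ⟫_ℂ := by
  rw [map_star, ContinuousLinearMap.star_eq_adjoint, ContinuousLinearMap.adjoint_inner_left]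
  rfl

theorem cyclicFunctional_cyclicVector (f : A →ₚ[ℂ] ℂ) (a : A) :
    cyclicFunctional f (cyclicVector f) a = f a := by
  have := inner_gns_cyclicVector f (star a) 1
  rwa [gns_one_cyclicVector, mul_one, star_star, ← cyclicFunctional_apply] at this

/-- The vectors `π(star a) Ω` are dense, so their inner products with a vector determine it. -/
theorem cyclicFunctional_injective (f : A →ₚ[ℂ] ℂ) {ξ η : f.GNS}
    (h : ∀ a, cyclicFunctional f ξ a = cyclicFunctional f η a) : ξ = η := by
  refine ext_inner_left ℂ fun x => ?_
  induction x using UniformSpace.Completion.induction_on with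
  | hp => apply isClosed_eq <;> fun_prop
  | ih x =>
    have := h (star (f.ofPreGNS x))
    rwa [cyclicFunctional_apply, cyclicFunctional_apply, star_star, gns_cyclicVector] at this

end GNS

end CStarDynamics

namespace NCTorus

open CStarDynamics
open scoped InnerProductSpace ComplexOrder

/-! ### Weyl unitaries and functionals on the noncommutative torus -/

variable {α : ℝ}

/-- The unitary `U ^ m * V ^ n`. -/
def weyl (α : ℝ) (m n : ℤ) : unitary (NCTorus α) := U α ^ m * V α ^ n

theorem weyl_zero_zero : weyl α 0 0 = 1 := by simp [weyl]

theorem weyl_zero_right (m : ℤ) : weyl α m 0 = U α ^ m := by simp [weyl]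

/-- The only place where the commutation relation enters the calculus modulo scalars: `e^{2πiα}` is
a phase and disappears. -/
theorem commute_projUnitary_U_V :
    Commute (projUnitary (NCTorus α) (U α)) (projUnitary (NCTorus α) (V α)) := by
  rw [Commute, SemiconjBy, ← map_mul, ← map_mul, projUnitary_eq_iff]
  refine ⟨Circle.exp (2 * Real.pi * α), Subtype.ext ?_⟩
  rw [coe_scaleUnitary, ← phase_eq]
  exact U_mul_V α

theorem projUnitary_weyl (m n : ℤ) : projUnitary (NCTorus α) (weyl α m n) =
    projUnitary (NCTorus α) (U α) ^ m * projUnitary (NCTorus α) (V α) ^ n := by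
  simp [weyl]

theorem projUnitary_weyl_mul (m n m' n' : ℤ) :
    projUnitary (NCTorus α) (weyl α m n) * projUnitary (NCTorus α) (weyl α m' n') =
      projUnitary (NCTorus α) (weyl α (m + m') (n + n')) := by
  simp only [projUnitary_weyl, zpow_add]
  exact ((commute_projUnitary_U_V (α := α)).zpow_zpow m' n).symm.mul_mul_mul_comm _ _

theorem projUnitary_weyl_inv (m n : ℤ) :
    (projUnitary (NCTorus α) (weyl α m n))⁻¹ = projUnitary (NCTorus α) (weyl α (-m) (-n)) := by
  rw [inv_eq_iff_mul_eq_one, projUnitary_weyl_mul, add_neg_cancel, add_neg_cancel, weyl_zero_zero,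
    map_one]

/-- The unitary of the noncommutative torus given by a word in the generators. -/
def word (α : ℝ) : FreeGroup Bool →* unitary (NCTorus α) :=
  FreeGroup.lift fun i => bif i then U α else V α

theorem ofPoly_mon (c : ℂ) (g : FreeGroup Bool) :
    ofPoly (Poly.mon α c g) = c • (word α g : NCTorus α) := by
  have h : ofPolyHom α = polyLift α (U α) (V α) :=
    polyHom_ext (polyLift_u (α := α) (U α) (V α)).symm (polyLift_v (α := α) (U α) (V α)).symm
  exact (DFunLike.congr_fun h _).trans (polyLiftAlgHom_mon _ _ c g)

/-- The classes of the Weyl unitaries modulo scalars contain those of the generators and are closed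
under products and inverses. -/
theorem exists_word_eq (g : FreeGroup Bool) :
    ∃ (c : Circle) (m n : ℤ), word α g = scaleUnitary c (weyl α m n) := by
  suffices ∃ m n : ℤ, projUnitary (NCTorus α) (word α g) = projUnitary (NCTorus α) (weyl α m n) by
    obtain ⟨m, n, h⟩ := this
    obtain ⟨c, h⟩ := projUnitary_eq_iff.1 h
    exact ⟨c, m, n, h⟩
  induction g using FreeGroup.induction_on with
  | C1 => exact ⟨0, 0, by rw [map_one, weyl_zero_zero]⟩
  | of i =>
    cases i
    · exact ⟨0, 1, by simp [word, weyl]⟩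
    · exact ⟨1, 0, by simp [word, weyl]⟩
  | inv_of i h =>
    obtain ⟨m, n, h⟩ := h
    exact ⟨-m, -n, by rw [map_inv, map_inv, h, projUnitary_weyl_inv]⟩
  | mul g h hg hh =>
    obtain ⟨m, n, hg⟩ := hg
    obtain ⟨m', n', hh⟩ := hh
    exact ⟨m + m', n + n', by rw [map_mul, map_mul, hg, hh, projUnitary_weyl_mul]⟩

/-- Bounded functionals that agree on the products `U ^ m * V ^ n` are equal. -/
theorem functional_ext {φ ψ : NCTorus α →L[ℂ] ℂ}
    (h : ∀ m n : ℤ, φ (weyl α m n : NCTorus α) = ψ (weyl α m n : NCTorus α)) : φ = ψ := by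
  ext x
  refine dense_induction (P := fun x => φ x = ψ x)
    (isClosed_eq φ.continuous ψ.continuous) (fun x => ?_) x
  induction x using Poly.induction with
  | h0 => rw [show ofPoly (0 : Poly α) = 0 from map_zero (ofPolyHom α), map_zero, map_zero]
  | hadd x y hx hy => rw [ofPoly_add, map_add, map_add, hx, hy]
  | hmon c g =>
    obtain ⟨d, m, n, hg⟩ := exists_word_eq (α := α) g
    rw [ofPoly_mon, hg, coe_scaleUnitary, map_smul, map_smul, map_smul, map_smul, h]

/-- A bounded functional that vanishes on `U ^ m * V ^ n` unless `m = n = 0` is a multiple of the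
trace. -/
theorem eq_smul_trace {φ : NCTorus α →L[ℂ] ℂ}
    (h : ∀ m n : ℤ, ¬(m = 0 ∧ n = 0) → φ (weyl α m n : NCTorus α) = 0) :
    φ = φ 1 • trace α := by
  refine functional_ext fun m n => ?_
  have ht : trace α (weyl α m n : NCTorus α) = _ := trace_zpow α m n
  rw [smul_apply, ht]
  split_ifs with hmn
  · rw [hmn.1, hmn.2, weyl_zero_zero]
    exact (mul_one _).symm
  · rw [h m n hmn, smul_zero]

/-! ### Endomorphisms that act as a shear up to phases -/

section SkewProduct

variable {Φ : NCTorus α →⋆ₐ[ℂ] NCTorus α} {c₁ c₂ : Circle}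

/-- Modulo scalars `V` goes to `U * V`, and `(U * V) ^ n` is `U ^ n * V ^ n` since the classes
commute. -/
theorem mapUnitary_weyl (hU : mapUnitary Φ (U α) = scaleUnitary c₁ (U α))
    (hV : mapUnitary Φ (V α) = scaleUnitary c₂ (U α * V α)) (m n : ℤ) :
    ∃ c : Circle, mapUnitary Φ (weyl α m n) = scaleUnitary c (weyl α (m + n) n) := by
  rw [← projUnitary_eq_iff, weyl, map_mul, map_zpow, map_zpow, hU, hV, map_mul, map_zpow, map_zpow,
    projUnitary_scaleUnitary, projUnitary_scaleUnitary, map_mul,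
    (commute_projUnitary_U_V (α := α)).mul_zpow, ← mul_assoc, ← zpow_add, projUnitary_weyl]

theorem iterate_star_weyl (hU : mapUnitary Φ (U α) = scaleUnitary c₁ (U α))
    (hV : mapUnitary Φ (V α) = scaleUnitary c₂ (U α * V α)) (m n : ℤ) (k : ℕ) :
    ∃ c : Circle, Φ^[k] (star (weyl α m n : NCTorus α)) =
      star (scaleUnitary c (weyl α (m + k * n) n) : NCTorus α) := by
  induction k with
  | zero =>
    refine ⟨1, ?_⟩
    rw [coe_scaleUnitary, Circle.coe_one, one_smul]
    simp
  | succ k ih =>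
    obtain ⟨c, hc⟩ := ih
    obtain ⟨d, hd⟩ := mapUnitary_weyl hU hV (m + k * n) n
    obtain ⟨e, he⟩ : ∃ e : Circle, mapUnitary Φ (scaleUnitary c (weyl α (m + k * n) n)) =
        scaleUnitary e (weyl α (m + (k + 1 : ℕ) * n) n) := by
      rw [← projUnitary_eq_iff, mapUnitary_scaleUnitary, projUnitary_scaleUnitary, hd,
        projUnitary_scaleUnitary]
      congr 2
      push_cast
      ring
    refine ⟨e, ?_⟩
    rw [Function.iterate_succ_apply', hc, map_star, ← he]
    rfl

/-- The shear sends only `(0, 0)` to `(0, 0)`, so off the origin the trace vanishes both before and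
after applying `Φ`. -/
theorem trace_comp (hU : mapUnitary Φ (U α) = scaleUnitary c₁ (U α))
    (hV : mapUnitary Φ (V α) = scaleUnitary c₂ (U α * V α)) (a : NCTorus α) :
    trace α (Φ a) = trace α a := by
  let Φ' : NCTorus α →L[ℂ] NCTorus α := ⟨(Φ : NCTorus α →ₗ[ℂ] NCTorus α), continuous_hom Φ⟩
  suffices (trace α).comp Φ' = trace α from DFunLike.congr_fun this a
  refine functional_ext fun m n => ?_
  show trace α (mapUnitary Φ (weyl α m n) : unitary (NCTorus α)) = _
  by_cases hmn : m = 0 ∧ n = 0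
  · obtain ⟨rfl, rfl⟩ := hmn
    rw [weyl_zero_zero, map_one]
  · obtain ⟨c, hc⟩ := mapUnitary_weyl hU hV m n
    rw [hc, coe_scaleUnitary, map_smul, weyl, weyl, trace_zpow, trace_zpow, if_neg hmn, if_neg,
      smul_zero]
    omega

theorem trace_mem_invariantStates (hU : mapUnitary Φ (U α) = scaleUnitary c₁ (U α))
    (hV : mapUnitary Φ (V α) = scaleUnitary c₂ (U α * V α)) :
    trace α ∈ invariantStates Φ := ⟨trace_mem_stateSpace α, trace_comp hU hV⟩

theorem map_U_zpow (hU : mapUnitary Φ (U α) = scaleUnitary c₁ (U α)) (m : ℤ) :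
    Φ (U α ^ m : unitary (NCTorus α)) = ((c₁ ^ m : Circle) : ℂ) •
      ((U α ^ m : unitary (NCTorus α)) : NCTorus α) := by
  have h : mapUnitary Φ (U α ^ m) = scaleUnitary (c₁ ^ m) (U α ^ m) := by
    have hc : Commute (scalarUnitary (NCTorus α) c₁) (U α) :=
      (scalarUnitary_mul _ _).trans (mul_scalarUnitary _ _).symm
    rw [map_zpow, hU, ← scalarUnitary_mul, ← scalarUnitary_mul, hc.mul_zpow, map_zpow]
  exact congrArg Subtype.val h

/-- Invariance gives `c₁ ^ m * φ (U ^ m) = φ (U ^ m)`, and `hc` says that `c₁` is not a root of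
unity. -/
theorem state_U_zpow (hU : mapUnitary Φ (U α) = scaleUnitary c₁ (U α))
    (hc : ∀ m : ℤ, c₁ ^ m = 1 → m = 0) {φ : NCTorus α →ₚ[ℂ] ℂ}
    (hφ : ∀ a, φ (Φ a) = φ a)
    {m : ℤ} (hm : m ≠ 0) : φ (U α ^ m : unitary (NCTorus α)) = 0 := by
  have h := hφ (U α ^ m : unitary (NCTorus α))
  rw [map_U_zpow hU, map_smul, smul_eq_mul, mul_left_eq_self₀] at h
  exact h.resolve_left fun h => hm (hc m (Circle.ext h))

/-- The shear keeps the exponent `n` of `V` and moves that of `U` by `n` at each step. In the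
product of one orbit member with the adjoint of another the powers of `V` cancel, leaving a nonzero
power of `U`, which `φ` kills. -/
theorem orthonormal_orbit_star_weyl (hU : mapUnitary Φ (U α) = scaleUnitary c₁ (U α))
    (hV : mapUnitary Φ (V α) = scaleUnitary c₂ (U α * V α))
    (hc : ∀ m : ℤ, c₁ ^ m = 1 → m = 0) {φ : NCTorus α →ₚ[ℂ] ℂ}
    (hφ : ∀ a, φ (Φ a) = φ a) (h1 : φ 1 = 1) (m : ℤ) {n : ℤ} (hn : n ≠ 0) :
    Orthonormal ℂ fun k : ℕ => (koopman φ Φ hφ)^[k]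
      (φ.gnsStarAlgHom (star (weyl α m n : NCTorus α))
        (cyclicVector φ)) := by
  rw [orthonormal_iff_ite]
  intro i j
  rw [koopman_iterate_gns, koopman_iterate_gns, inner_gns_cyclicVector]
  obtain ⟨c, hi⟩ := iterate_star_weyl hU hV m n i
  obtain ⟨d, hj⟩ := iterate_star_weyl hU hV m n j
  split_ifs with hij
  · subst hij
    rw [hi, star_star, Unitary.mul_star_self_of_mem (scaleUnitary c _).2, h1]
  · obtain ⟨e, he⟩ : ∃ e : Circle, scaleUnitary c (weyl α (m + i * n) n) *
        (scaleUnitary d (weyl α (m + j * n) n))⁻¹ = scaleUnitary e (U α ^ ((i - j) * n)) := by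
      rw [← projUnitary_eq_iff, map_mul, map_inv, projUnitary_scaleUnitary,
        projUnitary_scaleUnitary, projUnitary_weyl_inv, projUnitary_weyl_mul, ← weyl_zero_right]
      congr 2 <;> ring
    rw [hi, hj, star_star]
    refine (congrArg (fun u : unitary (NCTorus α) => φ u) he).trans ?_
    rw [coe_scaleUnitary, map_smul, state_U_zpow hU hc hφ, smul_zero]
    exact mul_ne_zero (sub_ne_zero.2 (by exact_mod_cast hij)) hn

/-- For an invariant state, the functional given by a fixed vector is a multiple of the trace. -/
theorem cyclicFunctional_eq_smul_trace (hU : mapUnitary Φ (U α) = scaleUnitary c₁ (U α))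
    (hV : mapUnitary Φ (V α) = scaleUnitary c₂ (U α * V α))
    (hc : ∀ m : ℤ, c₁ ^ m = 1 → m = 0) {φ : NCTorus α →ₚ[ℂ] ℂ}
    (hφ : ∀ a, φ (Φ a) = φ a)
    (h1 : φ 1 = 1) {ξ : φ.GNS} (hξ : koopman φ Φ hφ ξ = ξ) :
    cyclicFunctional φ ξ =
      cyclicFunctional φ ξ 1 • trace α := by
  refine eq_smul_trace fun m n hmn => ?_
  rw [cyclicFunctional_apply]
  by_cases hn : n = 0
  · subst hn
    have hm : m ≠ 0 := by simpa using hmn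
    -- The vector `π((U ^ m)*) Ω` is an eigenvector with eigenvalue the conjugate of `c₁ ^ m`, hence
    -- orthogonal to the fixed vector `ξ`.
    have h := inner_koopman φ Φ hφ
      (φ.gnsStarAlgHom (star (weyl α m 0 : NCTorus α))
        (cyclicVector φ)) ξ
    rw [hξ, koopman_gns, map_star, weyl_zero_right, map_U_zpow hU, star_smul, map_smul,
      smul_apply, inner_smul_left, Complex.star_def, Complex.conj_conj, mul_left_eq_self₀] at h
    rw [weyl_zero_right]
    exact h.resolve_left fun h => hm (hc m (Circle.ext h))
  · exact inner_eq_zero_of_orthonormal_orbit (inner_koopman φ Φ hφ) hξ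
      (orthonormal_orbit_star_weyl hU hV hc hφ h1 m hn)

/-- The cyclic vector is fixed and its functional is the state itself; the multiple of the trace is
fixed by the value `1` at the unit. -/
theorem invariantStates_eq (hU : mapUnitary Φ (U α) = scaleUnitary c₁ (U α))
    (hV : mapUnitary Φ (V α) = scaleUnitary c₂ (U α * V α))
    (hc : ∀ m : ℤ, c₁ ^ m = 1 → m = 0) : invariantStates Φ = {trace α} := by
  refine Set.Subset.antisymm (fun φ hφ => ?_)
    (Set.singleton_subset_iff.2 (trace_mem_invariantStates hU hV))
  have h := cyclicFunctional_eq_smul_trace hU hV hc (φ := toPositive φ hφ.1) hφ.2 hφ.1.2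
    (koopman_cyclicVector _ Φ hφ.2)
  have e : cyclicFunctional (toPositive φ hφ.1) (cyclicVector (toPositive φ hφ.1)) = φ :=
    ContinuousLinearMap.ext (cyclicFunctional_cyclicVector _)
  rwa [e, hφ.1.2, one_smul] at h

theorem isErgodic_trace (hU : mapUnitary Φ (U α) = scaleUnitary c₁ (U α))
    (hV : mapUnitary Φ (V α) = scaleUnitary c₂ (U α * V α))
    (hc : ∀ m : ℤ, c₁ ^ m = 1 → m = 0) : IsErgodic Φ (trace α) := by
  have hτ := trace_mem_invariantStates hU hV
  refine ⟨hτ, Set.ext fun ξ => ⟨fun hξ => ?_, fun hξ => ?_⟩⟩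
  · have h := cyclicFunctional_eq_smul_trace hU hV hc (φ := toPositive (trace α) hτ.1) hτ.2 hτ.1.2 hξ
    -- The coefficient is `⟪Ω, ξ⟫`, the value of the functional of `ξ` at `1`.
    refine Submodule.mem_span_singleton.2
      ⟨cyclicFunctional (toPositive (trace α) hτ.1) ξ 1, ?_⟩
    refine cyclicFunctional_injective _ fun a => ?_
    rw [cyclicFunctional_apply, inner_smul_right, ← cyclicFunctional_apply,
      cyclicFunctional_cyclicVector]
    exact (DFunLike.congr_fun h a).symm
  · obtain ⟨c, rfl⟩ := Submodule.mem_span_singleton.1 hξ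
    refine (map_smul _ c _).trans ?_
    exact congrArg (c • ·) (koopman_cyclicVector (toPositive (trace α) hτ.1) Φ hτ.2)

end SkewProduct

theorem unitaryCalculus_eq_scaleUnitary {A : Type*} [CStarAlgebra A] (u : unitary A) {z₀ : Circle}
    {f : C(Circle, Circle)} (hf : ∀ z, f z = z₀ * z) : unitaryCalculus u f = scaleUnitary z₀ u := by
  have e : f = (ContinuousMap.id Circle).comp (ContinuousMap.mulLeft z₀) := ContinuousMap.ext hf
  rw [e, unitaryCalculus_const_mul, unitaryCalculus_id]

theorem exp_zpow_eq_one {θ : ℝ} (hθ : Irrational (θ / (2 * Real.pi))) (m : ℤ)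
    (h : Circle.exp θ ^ m = 1) : m = 0 := by
  rw [← Circle.exp_zsmul, Circle.exp_eq_one] at h
  obtain ⟨n, h⟩ := h
  by_contra hm
  -- From `m * θ = n * 2π` with `m ≠ 0`, the ratio `θ / 2π` would be the rational `n / m`.
  refine hθ ⟨n / m, ?_⟩
  have hm' : (m : ℝ) ≠ 0 := by exact_mod_cast hm
  rw [zsmul_eq_mul] at h
  push_cast
  rw [div_eq_div_iff hm' Real.two_pi_pos.ne']
  linarith

end NCTorus

end

theorem mainTheorem8 (α θ : ℝ) (hθ : Irrational (θ / (2 * Real.pi))) (z₀ : Circle)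
    (f : C(Circle, Circle)) (hf : ∀ z : Circle, f z = z₀ * z) :
    CStarDynamics.IsErgodic (NCTorus.anzai α θ f : NCTorus α →⋆ₐ[ℂ] NCTorus α)
        (NCTorus.trace α) ∧
      CStarDynamics.IsErgodicState (NCTorus.anzai α θ f : NCTorus α →⋆ₐ[ℂ] NCTorus α)
        (NCTorus.trace α) ∧
      CStarDynamics.IsUniquelyErgodic (NCTorus.anzai α θ f : NCTorus α →⋆ₐ[ℂ] NCTorus α)
        (NCTorus.trace α) := by
  have hU : CStarDynamics.mapUnitary (NCTorus.anzai α θ f : NCTorus α →⋆ₐ[ℂ] NCTorus α)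
      (NCTorus.U α) = CStarDynamics.scaleUnitary (Circle.exp θ) (NCTorus.U α) :=
    Subtype.ext (NCTorus.anzai_U α θ f)
  have hV : CStarDynamics.mapUnitary (NCTorus.anzai α θ f : NCTorus α →⋆ₐ[ℂ] NCTorus α)
      (NCTorus.V α) = CStarDynamics.scaleUnitary z₀ (NCTorus.U α * NCTorus.V α) := by
    -- For this `f` the calculus gives `f(U) = z₀ U`, so `V` goes to a phase times `U * V`, as the
    -- shear argument requires.
    refine Subtype.ext ((NCTorus.anzai_V α θ f).trans ?_)
    rw [NCTorus.unitaryCalculus_eq_scaleUnitary _ hf, CStarDynamics.coe_scaleUnitary,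
      CStarDynamics.coe_scaleUnitary, smul_mul_assoc]
    rfl
  have hc := NCTorus.exp_zpow_eq_one hθ
  have h := NCTorus.invariantStates_eq hU hV hc
  refine ⟨NCTorus.isErgodic_trace hU hV hc, ?_, h⟩
  rw [CStarDynamics.IsErgodicState, h, extremePoints_singleton]
  rfl
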